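/- A circuit with $n$ inputs and $m$ outputs over arbitrary gates is a finite directed acyclic graph whose nodes are the $n$ input variables and a finite number of gates. Each gate has unbounded fan-in and computes an arbitrary Boolean function of the bits on its incoming wires (edges), and each of the $m$ output bits is read off at some node. The number of wires is the number of edges, and the depth is the number of edges on a longest directed path ending in an output node. For $M \in \mathbb{F}_2^{m \times n}$, a circuit $C$ computes $M$ if $C(x) = Mx$ for all $x \in \{0,1\}^n$. It has advantage $\varepsilon$ for $M$ if $$\Pr_{x \in \{0,1\}^n}\left[ C_i(x) = (Mx)_i \right] \ge \frac{1+\varepsilon}{2} \quad \text{for every } i \in \{1,\dots,m\},$$ where $x$ is uniformly random. A property holds for most linear operators $\{0,1\}^n \to \{0,1\}^{O(n)}$ if for every constant $K \in \mathbb{N}$ and every $\eta > 0$ there is an $N$ such that, for all $n \ge N$ and all $m$ with $n \le m \le Kn$, at least a $1-\eta$ fraction of the matrices $M \in \mathbb{F}_2^{m \times n}$ have it. **Theorem.** (1) There is an absolute constant $c > 0$ such that most linear operators $M : \{0,1\}^n \to \{0,1\}^{O(n)}$ have the following property: for every $d \ge 1$, every circuit of depth at most $d$ with arbitrary gates of unbounded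 fan-in that computes $M$ has at least $c \cdot n \cdot (\log_2 n)^{1/d}$ wires. (2) For every constant $\varepsilon > 0$ there is a constant $c = c(\varepsilon) > 0$ such that most linear operators $M : \{0,1\}^n \to \{0,1\}^{O(n)}$ have the following property: for every $d \ge 1$, every circuit of depth at most $d$ with arbitrary gates of unbounded fan-in that has advantage $\varepsilon$ for $M$ has at least $c \cdot n \cdot (\log_2 n)^{1/d}$ wires. -/

import Mathlib

/-- A Boolean circuit with `n` inputs and `m` outputs over arbitrary gates of unbounded fan-in.
The nodes are the `n` input variables (`Sum.inl`) and `size` gates (`Sum.inr`), the gates being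
listed in a topological order of the underlying directed acyclic graph. -/
structure Circuit (n m : ℕ) where
  /-- number of gates -/
  size : ℕ
  /-- the nodes from which a wire leads into the gate `g` -/
  preds : Fin size → Finset (Fin n ⊕ Fin size)
  /-- wires go forward in the order of the gates, so the graph is acyclic -/
  acyclic : ∀ g h : Fin size, Sum.inr h ∈ preds g → h < g
  /-- an arbitrary Boolean function of the incoming bits at each gate -/
  op : (g : Fin size) → (preds g → ZMod 2) → ZMod 2
  /-- the node at which each output bit is read off -/
  out : Fin m → Fin n ⊕ Fin size

namespace Circuit

variable {n m : ℕ} (C : Circuit n m)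

/-- The bit computed by a gate on the input `x`. -/
def gateVal (x : Fin n → ZMod 2) (g : Fin C.size) : ZMod 2 :=
  C.op g fun v =>
    match hv : v.1 with
    | Sum.inl i => x i
    | Sum.inr h => gateVal x h
termination_by g
decreasing_by exact C.acyclic g h (hv ▸ v.2)

/-- The bit carried by a node on the input `x`. -/
def nodeVal (x : Fin n → ZMod 2) : Fin n ⊕ Fin C.size → ZMod 2
  | Sum.inl i => x i
  | Sum.inr g => C.gateVal x g

/-- The `i`-th output bit on the input `x`. -/
def eval (x : Fin n → ZMod 2) (i : Fin m) : ZMod 2 :=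
  C.nodeVal x (C.out i)

/-- The number of wires on a longest path that ends in the gate `g`. -/
def gateDepth (g : Fin C.size) : ℕ :=
  (C.preds g).attach.sup fun v =>
    match hv : v.1 with
    | Sum.inl _ => 1
    | Sum.inr h => gateDepth h + 1
termination_by g
decreasing_by exact C.acyclic g h (hv ▸ v.2)

/-- The number of wires on a longest path that ends in a given node. -/
def nodeDepth : Fin n ⊕ Fin C.size → ℕ
  | Sum.inl _ => 0
  | Sum.inr g => C.gateDepth g

/-- The depth of the circuit: the number of wires on a longest path that ends in an output node. -/
def depth : ℕ :=
  Finset.univ.sup fun i : Fin m => C.nodeDepth (C.out i)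

/-- The total number of wires of the circuit. -/
def wires : ℕ :=
  ∑ g : Fin C.size, (C.preds g).card

/-- A gate applies its function to the bits carried by the nodes wired into it. -/
theorem gateVal_eq (x : Fin n → ZMod 2) (g : Fin C.size) :
    C.gateVal x g = C.op g fun v => C.nodeVal x v.1 := by
  rw [gateVal]
  congr 1
  funext v
  rcases v with ⟨_ | _, _⟩ <;> rfl

/-- A gate lies one level above the deepest node wired into it. -/
theorem gateDepth_eq (g : Fin C.size) :
    C.gateDepth g = (C.preds g).sup fun v => C.nodeDepth v + 1 := by
  rw [gateDepth, ← Finset.sup_attach (C.preds g) fun v => C.nodeDepth v + 1]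
  congr 1
  funext v
  rcases v with ⟨_ | _, _⟩ <;> rfl

/-- The circuit computes the linear operator `x ↦ M x` over `𝔽₂`. -/
def Computes (M : Matrix (Fin m) (Fin n) (ZMod 2)) : Prop :=
  ∀ x : Fin n → ZMod 2, C.eval x = M.mulVec x

/-- Every single output bit of the circuit agrees with that of `x ↦ M x` with probability at least
`(1 + ε) / 2` over a uniformly random input `x`. -/
def HasAdvantage (ε : ℝ) (M : Matrix (Fin m) (Fin n) (ZMod 2)) : Prop :=
  ∀ i : Fin m,
    (1 + ε) / 2 ≤
      ((Finset.univ.filter fun x : Fin n → ZMod 2 => C.eval x i = M.mulVec x i).card : ℝ) / 2 ^ n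

end Circuit

/-- `P` holds for most linear operators `𝔽₂ⁿ → 𝔽₂^{O(n)}`: for every constant `K`, the fraction of
the `m × n` matrices over `𝔽₂` with the property `P` tends to `1` as `n → ∞`, uniformly in the
number `m` of outputs with `n ≤ m ≤ K n`. -/
def ForMostOperators (P : (n m : ℕ) → Matrix (Fin m) (Fin n) (ZMod 2) → Prop) : Prop :=
  ∀ K : ℕ, ∀ η : ℝ, 0 < η → ∀ᶠ n : ℕ in Filter.atTop, ∀ m : ℕ, n ≤ m → m ≤ K * n →
    1 - η ≤
      ({M : Matrix (Fin m) (Fin n) (ZMod 2) | P n m M}.ncard : ℝ) /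
        (Nat.card (Matrix (Fin m) (Fin n) (ZMod 2)) : ℝ)

/-! Call a gate heavy if its fan-in exceeds `q`, about `(log n) ^ (1 / d)`. With fewer than `c * n *
(log n) ^ (1 / d)` wires there are at most `h = O(c n)` heavy gates. Once their values are fixed,
every output depends on at most `q ^ d ≤ t = log n / 2` inputs (`Circuit.exists_support_node`). By
averaging, a circuit with advantage `ε` is right on a fraction `(1 + ε / 2) / 2` of the outputs for
a constant fraction of the inputs. The most frequent pattern of heavy values then leaves one tuple
of `t`-juntas that nearly agrees with `M` on a `2 ^ (-h - O(1))` fraction of all inputs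
(`Circuit.HasAdvantage.exists_nearAgreement`).

Such a tuple is rare (`card_exists_nearAgreement_le`). So large a set of inputs contains many
independent `k`-tuples, `k = n / 4`. A random matrix sends each of these to independent uniform
vectors, all close to the junta values with probability at most `exp (-ε² m k / 8)`, by Chernoff.
This beats both the density loss `2 ^ (O(h) * k)` and the `exp (O(m √n log n))` tuples of juntas.
Circuits themselves are never counted, so the number of gates is irrelevant. -/

/-! ### Random matrices and linearly independent tuples. -/

open Finset in
/-- The preimage of a set under a surjective homomorphism of finite groups has the same density. -/
theorem AddMonoidHom.card_preimage_mul_card {G H : Type*} [AddGroup G] [Fintype G] [AddGroup H]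
    [Fintype H] [DecidableEq H] (f : G →+ H) (hf : Function.Surjective f) (S : Finset H) :
    #{g | f g ∈ S} * Fintype.card H = Fintype.card G * #S := by
  -- All fibres have the size of the kernel; the case `T = univ` expresses that size through the two
  -- orders.
  have key (T : Finset H) : #{g | f g ∈ T} = #T * #{g | f g = 0} := by
    rw [Finset.card_eq_sum_card_fiberwise (f := f) (t := T) (by intro g; simp)]
    rw [← smul_eq_mul, ← Finset.sum_const]
    refine Finset.sum_congr rfl fun y hy => ?_
    rw [← AddMonoidHom.card_fiber_eq_of_mem_range f (hf y) (hf 0)]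
    congr 1
    ext g
    simp only [mem_filter, mem_univ, true_and]
    exact ⟨fun h => h.2, fun h => ⟨h ▸ hy, h⟩⟩
  have hG := key Finset.univ
  simp only [mem_univ, Finset.filter_true, Finset.card_univ] at hG
  rw [key S, hG]
  ring

/-- A linearly independent family can be sent to arbitrary vectors by a matrix. -/
theorem Matrix.exists_mulVec_eq_of_linearIndependent {K : Type*} [Field K] {m n k : ℕ}
    {x : Fin k → Fin n → K} (hx : LinearIndependent K x) (y : Fin k → Fin m → K) :
    ∃ M : Matrix (Fin m) (Fin n) K, ∀ j, M.mulVec (x j) = y j := by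
  obtain ⟨g, hg⟩ := LinearMap.exists_leftInverse_of_injective
    (Finsupp.linearCombination K x) (LinearMap.ker_eq_bot.2 hx)
  refine ⟨LinearMap.toMatrix' (Finsupp.linearCombination K y ∘ₗ g), fun j => ?_⟩
  rw [LinearMap.toMatrix'_mulVec]
  have := LinearMap.congr_fun hg (Finsupp.single j 1)
  simp only [LinearMap.comp_apply, Finsupp.linearCombination_single, one_smul,
    LinearMap.id_apply] at this
  simp [this]

open Finset in
/-- A random matrix sends linearly independent vectors to independent uniform vectors. -/
theorem card_matrix_mulVec_mem {m n k : ℕ} {x : Fin k → Fin n → ZMod 2}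
    (hx : LinearIndependent (ZMod 2) x) (B : Fin k → Finset (Fin m → ZMod 2)) :
    #{M : Matrix (Fin m) (Fin n) (ZMod 2) | ∀ j, M.mulVec (x j) ∈ B j} * 2 ^ (m * k) =
      2 ^ (m * n) * ∏ j, #(B j) := by
  classical
  let f : Matrix (Fin m) (Fin n) (ZMod 2) →+ (Fin k → Fin m → ZMod 2) :=
    { toFun := fun M j => M.mulVec (x j)
      map_zero' := by ext; simp
      map_add' := fun M N => by ext; simp [Matrix.add_mulVec] }
  have hf : Function.Surjective f := fun y =>
    let ⟨M, hM⟩ := Matrix.exists_mulVec_eq_of_linearIndependent hx y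
    ⟨M, funext hM⟩
  have h := f.card_preimage_mul_card hf (Fintype.piFinset B)
  have h1 : Fintype.card (Fin k → Fin m → ZMod 2) = 2 ^ (m * k) := by
    simp [pow_mul]
  have h2 : Fintype.card (Matrix (Fin m) (Fin n) (ZMod 2)) = 2 ^ (m * n) := by
    rw [Fintype.card_eq_nat_card, Matrix, Nat.card_fun, Nat.card_fun]
    simp [← pow_mul, mul_comm]
  rw [h1, h2, Fintype.card_piFinset] at h
  rw [← h]
  congr 2
  ext M
  simp [f, Fintype.mem_piFinset]

open Finset in
open scoped Classical in
/-- A large set of vectors contains many linearly independent tuples. -/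
theorem pow_le_card_linearIndependent {n : ℕ} (A : Finset (Fin n → ZMod 2)) {b K : ℕ}
    (hA : b + 2 ^ K ≤ #A) (k : ℕ) (hk : k ≤ K) :
    b ^ k ≤ #{x : Fin k → Fin n → ZMod 2 | LinearIndependent (ZMod 2) x ∧ ∀ j, x j ∈ A} := by
  induction k with
  | zero =>
    simp only [pow_zero, Finset.one_le_card]
    exact ⟨fun j => j.elim0, Finset.mem_filter.2 ⟨Finset.mem_univ _, linearIndependent_empty_type,
      fun j => j.elim0⟩⟩
  | succ k ih =>
    set S : Finset (Fin k → Fin n → ZMod 2) :=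
      {x | LinearIndependent (ZMod 2) x ∧ ∀ j, x j ∈ A} with hS
    let T (x : Fin k → Fin n → ZMod 2) : Finset (Fin n → ZMod 2) :=
      {v ∈ A | v ∉ Submodule.span (ZMod 2) (Set.range x)}
    have hT : ∀ x ∈ S, b ≤ #(T x) := by
      intro x hx
      have hx1 : LinearIndependent (ZMod 2) x := (by simpa [hS] using hx :
        LinearIndependent (ZMod 2) x ∧ ∀ j, x j ∈ A).1
      -- Greedy extension: only the `2 ^ k` vectors of the span are forbidden, so at least `b`
      -- choices remain in `A`.
      have hspan : #{v ∈ A | v ∈ Submodule.span (ZMod 2) (Set.range x)} ≤ 2 ^ k := by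
        calc #{v ∈ A | v ∈ Submodule.span (ZMod 2) (Set.range x)}
            ≤ #{v | v ∈ Submodule.span (ZMod 2) (Set.range x)} :=
              Finset.card_le_card (Finset.filter_subset_filter _ (Finset.subset_univ _))
          _ = Fintype.card (Submodule.span (ZMod 2) (Set.range x)) :=
              (Fintype.card_subtype _).symm
          _ = 2 ^ k := by
              rw [Module.card_eq_pow_finrank (K := ZMod 2), finrank_span_eq_card hx1]
              simp
      have := Finset.card_filter_add_card_filter_not (s := A)
        (fun v => v ∈ Submodule.span (ZMod 2) (Set.range x))
      have h2 : 2 ^ k ≤ 2 ^ K := Nat.pow_le_pow_right (by norm_num) (by omega)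
      simp only [T]
      omega
    calc b ^ (k + 1) = b ^ k * b := pow_succ _ _
      _ ≤ #S * b := Nat.mul_le_mul_right _ (ih (by omega))
      _ ≤ ∑ x ∈ S, #(T x) := by
          rw [← smul_eq_mul, ← Finset.sum_const]
          exact Finset.sum_le_sum hT
      _ = #(S.sigma T) := (Finset.card_sigma _ _).symm
      _ ≤ _ := by
          refine Finset.card_le_card_of_injOn
            (fun p => (Fin.cons p.2 p.1 : Fin (k + 1) → Fin n → ZMod 2)) ?_ ?_
          · rintro ⟨x, v⟩ hp
            simp only [S, T, Finset.coe_sigma, Set.mem_sigma_iff, Finset.mem_coe,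
              Finset.mem_filter, Finset.mem_univ, true_and] at hp
            simp only [Finset.coe_filter, Finset.mem_univ, true_and, Set.mem_ofPred_eq]
            refine ⟨linearIndependent_finCons.2 ⟨hp.1.1, hp.2.2⟩, fun j => ?_⟩
            refine Fin.cases ?_ (fun j => ?_) j
            · exact hp.2.1
            · exact hp.1.2 j
          · rintro ⟨x, v⟩ _ ⟨x', v'⟩ _ h
            have h' := Fin.cons_injective2 h
            simp only at h'
            obtain ⟨rfl, rfl⟩ := h'
            rfl

/-! ### Chernoff bound and double counting of matrices against tuples. -/

/-- The number of positions at which two vectors agree. -/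
def agreement {m : ℕ} (y z : Fin m → ZMod 2) : ℕ :=
  (Finset.univ.filter fun i => y i = z i).card

open Finset in
/-- Chernoff bound: few vectors agree with a given one on noticeably more than half of the
positions. -/
theorem card_agreement_le {m : ℕ} (z : Fin m → ZMod 2) {ε : ℝ} (hε : 0 < ε) :
    (#{y | (1 + ε) / 2 * m ≤ (agreement y z : ℝ)} : ℝ) ≤
      2 ^ m * Real.exp (-(ε ^ 2 / 2) * m) := by
  let s (i : Fin m) (b : ZMod 2) : ℝ := if b = z i then 1 else -1
  have hsum (y : Fin m → ZMod 2) : ∑ i, s i (y i) = 2 * agreement y z - m := by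
    have : ∀ i, s i (y i) = 2 * (if y i = z i then 1 else 0) - 1 := by
      intro i; simp only [s]; split_ifs <;> norm_num
    simp only [this, Finset.sum_sub_distrib, ← Finset.mul_sum, Finset.sum_boole, agreement]
    simp
  have hone (i : Fin m) : ∑ b, Real.exp (ε * s i b) = 2 * Real.cosh ε := by
    have h2 : ∀ w : ZMod 2, ∑ b, Real.exp (ε * (if b = w then 1 else -1)) =
        Real.exp ε + Real.exp (-ε) := by
      intro w
      have hu : (Finset.univ : Finset (ZMod 2)) = {0, 1} := rfl
      rw [hu, Finset.sum_pair (by decide)]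
      rcases (by decide : ∀ w : ZMod 2, w = 0 ∨ w = 1) w with rfl | rfl
      · simp
      · simp [add_comm]
    rw [h2, Real.cosh_eq]; ring
  have htot : ∑ y : Fin m → ZMod 2, Real.exp (ε * ∑ i, s i (y i)) = (2 * Real.cosh ε) ^ m := by
    simp only [Finset.mul_sum, Real.exp_sum]
    have := Finset.prod_univ_sum (fun _ : Fin m => (Finset.univ : Finset (ZMod 2)))
      (fun i b => Real.exp (ε * s i b))
    rw [Fintype.piFinset_univ] at this
    rw [← this]
    simp [hone]
  -- Markov's inequality for the exponential moment with parameter `ε`; the counted `y` have sign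
  -- sum at least `ε * m`.
  have hmark : (#{y | (1 + ε) / 2 * m ≤ (agreement y z : ℝ)} : ℝ) * Real.exp (ε * (ε * m)) ≤
      (2 * Real.cosh ε) ^ m := by
    rw [← htot, ← nsmul_eq_mul, ← Finset.sum_const]
    refine (Finset.sum_le_sum fun y hy => ?_).trans
      (Finset.sum_le_sum_of_subset_of_nonneg (Finset.filter_subset _ _) fun _ _ _ =>
        (Real.exp_pos _).le)
    have hy' := (Finset.mem_filter.1 hy).2
    rw [hsum]
    gcongr
    linarith
  have hcosh : (2 * Real.cosh ε) ^ m ≤ 2 ^ m * Real.exp (ε ^ 2 / 2 * m) := by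
    rw [mul_pow, mul_comm (ε ^ 2 / 2), Real.exp_nat_mul]
    gcongr
    exact Real.cosh_le_exp_half_sq ε
  have h3 := hmark.trans hcosh
  rw [← le_div_iff₀ (Real.exp_pos _), mul_div_assoc, ← Real.exp_sub] at h3
  refine h3.trans_eq ?_
  congr 2
  ring

open Finset in
/-- If a fixed function `f` has few near-agreements with any target, then few matrices nearly agree
with `f` on a large set of inputs. -/
theorem card_matrix_agree_mul_pow_le {m n k b β : ℕ}
    (Φ : (Fin n → ZMod 2) → Finset (Fin m → ZMod 2))
    (hΦ : ∀ x, #(Φ x) ≤ β) :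
    #{M : Matrix (Fin m) (Fin n) (ZMod 2) |
        b + 2 ^ k ≤ #{x : Fin n → ZMod 2 | M.mulVec x ∈ Φ x}} * b ^ k * 2 ^ (m * k) ≤
      2 ^ (n * k) * 2 ^ (m * n) * β ^ k := by
  classical
  set T : Finset (Matrix (Fin m) (Fin n) (ZMod 2)) :=
    {M | b + 2 ^ k ≤ #{x : Fin n → ZMod 2 | M.mulVec x ∈ Φ x}}
  let X : Finset (Fin k → Fin n → ZMod 2) := {x | LinearIndependent (ZMod 2) x}
  -- Pairs of a matrix and an independent tuple are counted in both orders; each matrix in `T` has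
  -- at least `b ^ k` good tuples.
  have h1 : #T * b ^ k ≤ ∑ M ∈ T, #{x ∈ X | ∀ j, M.mulVec (x j) ∈ Φ (x j)} := by
    rw [← smul_eq_mul, ← Finset.sum_const]
    refine Finset.sum_le_sum fun M hM => ?_
    have := pow_le_card_linearIndependent _ (Finset.mem_filter.1 hM).2 k le_rfl
    refine this.trans_eq ?_
    congr 1
    ext x
    simp [X]
  have h2 : ∑ M ∈ T, #{x ∈ X | ∀ j, M.mulVec (x j) ∈ Φ (x j)} ≤
      ∑ x ∈ X, #{M : Matrix (Fin m) (Fin n) (ZMod 2) | ∀ j, M.mulVec (x j) ∈ Φ (x j)} := by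
    refine (Finset.sum_le_sum_of_subset (Finset.subset_univ T)).trans_eq ?_
    exact (Finset.sum_card_bipartiteAbove_eq_sum_card_bipartiteBelow
      (fun (x : Fin k → Fin n → ZMod 2) (M : Matrix (Fin m) (Fin n) (ZMod 2)) =>
        ∀ j, M.mulVec (x j) ∈ Φ (x j)) (s := X) (t := Finset.univ)).symm
  have h3 : ∀ x ∈ X,
      #{M : Matrix (Fin m) (Fin n) (ZMod 2) | ∀ j, M.mulVec (x j) ∈ Φ (x j)} * 2 ^ (m * k) ≤
        2 ^ (m * n) * β ^ k := by
    intro x hx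
    rw [card_matrix_mulVec_mem (Finset.mem_filter.1 hx).2 fun j => Φ (x j)]
    gcongr
    calc ∏ j, #(Φ (x j)) ≤ ∏ _j : Fin k, β := Finset.prod_le_prod' fun j _ => hΦ _
      _ = β ^ k := by simp
  have h4 : #X ≤ 2 ^ (n * k) := by
    refine (Finset.card_le_univ _).trans_eq ?_
    simp [pow_mul]
  calc #T * b ^ k * 2 ^ (m * k)
      ≤ (∑ x ∈ X, #{M : Matrix (Fin m) (Fin n) (ZMod 2) | ∀ j, M.mulVec (x j) ∈ Φ (x j)}) *
          2 ^ (m * k) := Nat.mul_le_mul_right _ (h1.trans h2)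
    _ ≤ ∑ x ∈ X, 2 ^ (m * n) * β ^ k := by
        rw [Finset.sum_mul]; exact Finset.sum_le_sum h3
    _ ≤ 2 ^ (n * k) * 2 ^ (m * n) * β ^ k := by
        rw [Finset.sum_const, smul_eq_mul, mul_assoc]
        exact Nat.mul_le_mul_right _ h4

/-! ### Reduction of circuits to juntas. -/

open Finset in
/-- Once the values of all gates of fan-in larger than `q` are known, a node depends on at most
`q ^ depth` inputs. -/
theorem Circuit.exists_support_node {n m : ℕ} (C : Circuit n m) {q : ℕ} (hq : 1 ≤ q)
    (v : Fin n ⊕ Fin C.size) :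
    ∃ S : Finset (Fin n), #S ≤ q ^ C.nodeDepth v ∧ ∀ x x' : Fin n → ZMod 2,
      (∀ g, q < #(C.preds g) → C.gateVal x g = C.gateVal x' g) → (∀ i ∈ S, x i = x' i) →
        C.nodeVal x v = C.nodeVal x' v := by
  classical
  rcases v with i | g
  · exact ⟨{i}, by simp [Circuit.nodeDepth], fun x x' _ h => h i (by simp)⟩
  induction g using WellFoundedLT.induction with
  | ind g ih =>
  by_cases hg : q < #(C.preds g)
  -- The value of a heavy gate is among the known ones, so it needs no support.
  · exact ⟨∅, by simp, fun x x' h _ => h g hg⟩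
  have hex : ∀ v : Fin n ⊕ Fin C.size, ∃ S : Finset (Fin n), v ∈ C.preds g →
      #S ≤ q ^ C.nodeDepth v ∧ ∀ x x' : Fin n → ZMod 2,
        (∀ g, q < #(C.preds g) → C.gateVal x g = C.gateVal x' g) → (∀ i ∈ S, x i = x' i) →
          C.nodeVal x v = C.nodeVal x' v := by
    rintro (i | h)
    · exact ⟨{i}, fun _ => ⟨by simp [Circuit.nodeDepth], fun x x' _ h => h i (by simp)⟩⟩
    · by_cases hv : Sum.inr h ∈ C.preds g
      · obtain ⟨S, hS⟩ := ih h (C.acyclic g h hv)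
        exact ⟨S, fun _ => hS⟩
      · exact ⟨∅, fun h => absurd h hv⟩
  choose S hS using hex
  refine ⟨(C.preds g).biUnion S, ?_, fun x x' hx hi => ?_⟩
  -- The extra factor `q` lifts each predecessor's bound to `q ^ C.gateDepth g` and then absorbs the
  -- at most `q` predecessors.
  · refine Nat.le_of_mul_le_mul_right ?_ (Nat.lt_of_lt_of_le Nat.zero_lt_one hq)
    calc #((C.preds g).biUnion S) * q ≤ (∑ v ∈ C.preds g, #(S v)) * q :=
          Nat.mul_le_mul_right _ Finset.card_biUnion_le
      _ = ∑ v ∈ C.preds g, #(S v) * q := Finset.sum_mul _ _ _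
      _ ≤ ∑ _v ∈ C.preds g, q ^ C.gateDepth g := by
          refine Finset.sum_le_sum fun v hv => ?_
          have hd : C.nodeDepth v + 1 ≤ C.gateDepth g := by
            rw [C.gateDepth_eq]
            exact Finset.le_sup (f := fun v => C.nodeDepth v + 1) hv
          calc #(S v) * q ≤ q ^ C.nodeDepth v * q := Nat.mul_le_mul_right _ (hS v hv).1
            _ = q ^ (C.nodeDepth v + 1) := (pow_succ _ _).symm
            _ ≤ q ^ C.gateDepth g := Nat.pow_le_pow_right hq hd
      _ = #(C.preds g) * q ^ C.gateDepth g := by simp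
      _ ≤ q ^ C.gateDepth g * q := by
          rw [mul_comm]
          exact Nat.mul_le_mul_left _ (not_lt.1 hg)
  · change C.gateVal x g = C.gateVal x' g
    rw [C.gateVal_eq, C.gateVal_eq]
    congr 1
    funext v
    exact (hS v.1 v.2).2 x x' hx fun i h => hi i (Finset.mem_biUnion.2 ⟨v.1, v.2, h⟩)

/-- The function with output bits depending on at most `t` inputs each that is described by the
positions of these inputs and the Boolean functions applied to them. -/
def juntaEval {n m t : ℕ} (p : Fin m → (Fin t → Fin n) × ((Fin t → ZMod 2) → ZMod 2))
    (x : Fin n → ZMod 2) (i : Fin m) : ZMod 2 :=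
  (p i).2 fun j => x ((p i).1 j)

/-- A small finite set is contained in the range of a tuple. -/
theorem Finset.exists_subset_range_fin {n t : ℕ} (hn : 0 < n) (S : Finset (Fin n))
    (hS : S.card ≤ t) : ∃ e : Fin t → Fin n, ∀ i ∈ S, ∃ j, e j = i := by
  refine ⟨fun j => if h : (j : ℕ) < S.card then S.orderEmbOfFin rfl ⟨j, h⟩ else ⟨0, hn⟩,
    fun i hi => ?_⟩
  have : i ∈ Set.range (S.orderEmbOfFin rfl) := by rw [Finset.range_orderEmbOfFin]; exact hi
  obtain ⟨j, hj⟩ := this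
  exact ⟨⟨j, j.2.trans_le hS⟩, by simpa using hj⟩

open Finset in
/-- On a large part of any set of inputs, a circuit with few gates of large fan-in is a tuple of
juntas. -/
theorem Circuit.exists_juntaEval_eq {n m d q t : ℕ} (hn : 0 < n) (C : Circuit n m)
    (hd : C.depth ≤ d) (hq : 1 ≤ q) (hqt : q ^ d ≤ t) (G : Finset (Fin n → ZMod 2)) :
    ∃ p : Fin m → (Fin t → Fin n) × ((Fin t → ZMod 2) → ZMod 2),
      #G ≤ #{x ∈ G | C.eval x = juntaEval p x} * 2 ^ #{g | q < #(C.preds g)} := by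
  classical
  choose S hSc hS using fun i : Fin m => C.exists_support_node hq (C.out i)
  have hSt (i : Fin m) : #(S i) ≤ t :=
    (hSc i).trans <| (Nat.pow_le_pow_right hq <|
      (Finset.le_sup (f := fun i => C.nodeDepth (C.out i)) (Finset.mem_univ i)).trans hd).trans hqt
  choose e he using fun i => (S i).exists_subset_range_fin hn (hSt i)
  let sig (x : Fin n → ZMod 2) (g : {g // q < #(C.preds g)}) : ZMod 2 := C.gateVal x g
  -- The most frequent pattern of heavy values on `G`, kept by at least a `2 ^ (-#heavy)` fraction
  -- of `G`.
  obtain ⟨a, -, ha⟩ := Finset.exists_max_image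
    (Finset.univ : Finset ({g // q < #(C.preds g)} → ZMod 2))
    (fun a => #{x ∈ G | sig x = a}) ⟨0, Finset.mem_univ _⟩
  have hG := Finset.card_le_mul_card_image_of_maps_to (f := sig) (s := G) (t := Finset.univ)
    (fun _ _ => Finset.mem_univ _) _ (fun b hb => ha b hb)
  have hex : ∀ (i : Fin m) (y : Fin t → ZMod 2), ∃ b : ZMod 2, ∀ x, sig x = a →
      (fun j => x (e i j)) = y → C.eval x i = b := by
    intro i y
    by_cases h : ∃ x, sig x = a ∧ (fun j => x (e i j)) = y
    · obtain ⟨x, hx, hy⟩ := h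
      refine ⟨C.eval x i, fun x' hx' hy' => hS i x' x (fun g hg => ?_) fun l hl => ?_⟩
      · exact congrFun (hx'.trans hx.symm) ⟨g, hg⟩
      · obtain ⟨j, rfl⟩ := he i l hl
        exact congrFun (hy'.trans hy.symm) j
    -- Local patterns incompatible with `a` get a dummy value.
    · exact ⟨0, fun x hx hy => absurd ⟨x, hx, hy⟩ h⟩
  choose f hf using hex
  refine ⟨fun i => (e i, f i), hG.trans (Nat.mul_le_mul (Finset.card_le_card ?_) (le_of_eq ?_))⟩
  · intro x hx
    rw [Finset.mem_filter] at hx ⊢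
    exact ⟨hx.1, funext fun i => hf i _ x hx.2 rfl⟩
  · simp [Fintype.card_subtype]

open Finset in
/-- Averaging: a circuit with advantage `ε` nearly agrees with the operator on many inputs. -/
theorem Circuit.HasAdvantage.card_agreement_ge {n m : ℕ} (hm : 0 < m) {C : Circuit n m} {ε : ℝ}
    (hε : 0 < ε) {M : Matrix (Fin m) (Fin n) (ZMod 2)} (h : C.HasAdvantage ε M) :
    ε / 4 * 2 ^ n ≤
      (#{x | (1 + ε / 2) / 2 * m ≤ (agreement (M.mulVec x) (C.eval x) : ℝ)} : ℝ) := by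
  have hswap : ∑ x, (agreement (M.mulVec x) (C.eval x) : ℝ) =
      ∑ i, (#{x : Fin n → ZMod 2 | C.eval x i = M.mulVec x i} : ℝ) := by
    have h := Finset.sum_card_bipartiteAbove_eq_sum_card_bipartiteBelow
      (fun (x : Fin n → ZMod 2) (i : Fin m) => C.eval x i = M.mulVec x i)
      (s := Finset.univ) (t := Finset.univ)
    simp only [Finset.bipartiteAbove, Finset.bipartiteBelow] at h
    simp only [agreement, @eq_comm _ (M.mulVec _ _)]
    exact_mod_cast h
  have hlow : (1 + ε) / 2 * 2 ^ n * m ≤ ∑ x, (agreement (M.mulVec x) (C.eval x) : ℝ) := by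
    rw [hswap]
    calc (1 + ε) / 2 * 2 ^ n * m = ∑ _i : Fin m, (1 + ε) / 2 * 2 ^ n := by simp; ring
      _ ≤ _ := Finset.sum_le_sum fun i _ => (le_div_iff₀ (by positivity)).1 (h i)
  -- An input below the threshold contributes at most the threshold, any other at most `m` more; the
  -- gap to `(1 + ε) / 2` is `ε / 4`.
  have hup : ∑ x, (agreement (M.mulVec x) (C.eval x) : ℝ) ≤
      ∑ x, ((1 + ε / 2) / 2 * m +
        if (1 + ε / 2) / 2 * m ≤ (agreement (M.mulVec x) (C.eval x) : ℝ) then (m : ℝ) else 0) := by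
    refine Finset.sum_le_sum fun x _ => ?_
    have h1 : (agreement (M.mulVec x) (C.eval x) : ℝ) ≤ m := by
      have := Finset.card_le_univ (Finset.univ.filter fun i => M.mulVec x i = C.eval x i)
      rw [Fintype.card_fin] at this
      exact_mod_cast this
    split_ifs with h2
    · have : 0 ≤ (1 + ε / 2) / 2 * m := by positivity
      linarith
    · linarith
  rw [Finset.sum_add_distrib, ← Finset.sum_filter] at hup
  simp only [Finset.sum_const, nsmul_eq_mul, Finset.card_univ, Fintype.card_pi, ZMod.card,
    Finset.prod_const, Fintype.card_fin] at hup
  push_cast at hup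
  have h3 := hlow.trans hup
  have hm' : (0 : ℝ) < m := by exact_mod_cast hm
  refine le_of_mul_le_mul_right ?_ hm'
  linarith

/-! ### Union bound over tuples of juntas. -/

/-- The inputs on which the operator `M` nearly agrees with a tuple of juntas. -/
noncomputable def nearAgreement {n m t : ℕ} (ε : ℝ) (M : Matrix (Fin m) (Fin n) (ZMod 2))
    (p : Fin m → (Fin t → Fin n) × ((Fin t → ZMod 2) → ZMod 2)) : Finset (Fin n → ZMod 2) :=
  {x | (1 + ε / 2) / 2 * m ≤ (agreement (M.mulVec x) (juntaEval p x) : ℝ)}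

open Finset in
open scoped Classical in
/-- Few matrices nearly agree with a tuple of juntas on a large set of inputs. -/
theorem card_exists_nearAgreement_le {n m t k s : ℕ} {ε : ℝ} (hε : 0 < ε) (hs : s + 1 + k ≤ n) :
    (#{M : Matrix (Fin m) (Fin n) (ZMod 2) |
        ∃ p : Fin m → (Fin t → Fin n) × ((Fin t → ZMod 2) → ZMod 2),
          2 ^ (n - s) ≤ #(nearAgreement ε M p)} : ℝ) ≤
      2 ^ (m * n) * ((n ^ t * 2 ^ 2 ^ t) ^ m * (2 ^ (s + 1) * Real.exp (-(ε ^ 2 / 8) * m)) ^ k) := by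
  set E := Real.exp (-(ε ^ 2 / 8) * m) with hE
  have hfix (p : Fin m → (Fin t → Fin n) × ((Fin t → ZMod 2) → ZMod 2)) :
      (#{M : Matrix (Fin m) (Fin n) (ZMod 2) | 2 ^ (n - s) ≤ #(nearAgreement ε M p)} : ℝ) ≤
        2 ^ (m * n) * (2 ^ (s + 1) * E) ^ k := by
    let Φ (x : Fin n → ZMod 2) : Finset (Fin m → ZMod 2) :=
      {y | (1 + ε / 2) / 2 * m ≤ (agreement y (juntaEval p x) : ℝ)}
    have hΦ : ∀ x, #(Φ x) ≤ ⌊2 ^ m * E⌋₊ := by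
      intro x
      refine Nat.le_floor ((card_agreement_le (juntaEval p x) (half_pos hε)).trans_eq ?_)
      rw [hE]
      congr 3
      ring
    -- Half of the `2 ^ (n - s)` inputs serve as `b`; the other half covers the spans, as `k ≤ n -
    -- (s + 1)`.
    have h := card_matrix_agree_mul_pow_le (k := k) (b := 2 ^ (n - (s + 1))) Φ hΦ
    have hsub : #{M : Matrix (Fin m) (Fin n) (ZMod 2) | 2 ^ (n - s) ≤ #(nearAgreement ε M p)} ≤
        #{M : Matrix (Fin m) (Fin n) (ZMod 2) | 2 ^ (n - (s + 1)) + 2 ^ k ≤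
          #{x : Fin n → ZMod 2 | M.mulVec x ∈ Φ x}} := by
      refine Finset.card_le_card fun M hM => ?_
      rw [Finset.mem_filter] at hM ⊢
      refine ⟨hM.1, ?_⟩
      have h1 : 2 ^ k ≤ 2 ^ (n - (s + 1)) := Nat.pow_le_pow_right (by norm_num) (by omega)
      have h2 : 2 ^ (n - s) = 2 * 2 ^ (n - (s + 1)) := by
        rw [← pow_succ']; congr 1; omega
      have h3 : #(nearAgreement ε M p) = #{x : Fin n → ZMod 2 | M.mulVec x ∈ Φ x} := by
        congr 1
        ext x
        simp [nearAgreement, Φ]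
      have := hM.2
      omega
    have h' := (Nat.mul_le_mul_right _ (Nat.mul_le_mul_right _ hsub)).trans h
    have hR : (#{M : Matrix (Fin m) (Fin n) (ZMod 2) | 2 ^ (n - s) ≤ #(nearAgreement ε M p)} : ℝ) *
        (2 ^ (n - (s + 1))) ^ k * 2 ^ (m * k) ≤ 2 ^ (n * k) * 2 ^ (m * n) * (2 ^ m * E) ^ k := by
      calc _ ≤ (2 : ℝ) ^ (n * k) * 2 ^ (m * n) * (⌊2 ^ m * E⌋₊ : ℝ) ^ k := by exact_mod_cast h'
        _ ≤ _ := by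
          gcongr
          exact Nat.floor_le (by positivity)
    have hpow : (2 : ℝ) ^ (n * k) = (2 ^ (s + 1)) ^ k * (2 ^ (n - (s + 1))) ^ k := by
      rw [← mul_pow, ← pow_add, pow_mul]
      congr 2
      omega
    rw [hpow] at hR
    have hpos : (0 : ℝ) < (2 ^ (n - (s + 1))) ^ k * 2 ^ (m * k) := by positivity
    refine le_of_mul_le_mul_right ?_ hpos
    rw [← mul_assoc]
    refine hR.trans_eq ?_
    rw [mul_pow (2 ^ m), mul_pow (2 ^ (s + 1)), pow_mul 2 m k]
    ring
  have hunion : #{M : Matrix (Fin m) (Fin n) (ZMod 2) |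
        ∃ p : Fin m → (Fin t → Fin n) × ((Fin t → ZMod 2) → ZMod 2),
          2 ^ (n - s) ≤ #(nearAgreement ε M p)} ≤
      ∑ p : Fin m → (Fin t → Fin n) × ((Fin t → ZMod 2) → ZMod 2),
        #{M : Matrix (Fin m) (Fin n) (ZMod 2) | 2 ^ (n - s) ≤ #(nearAgreement ε M p)} := by
    refine le_trans (Finset.card_le_card fun M hM => ?_) Finset.card_biUnion_le
    simpa using hM
  calc _ ≤ ∑ p : Fin m → (Fin t → Fin n) × ((Fin t → ZMod 2) → ZMod 2),
        (#{M : Matrix (Fin m) (Fin n) (ZMod 2) | 2 ^ (n - s) ≤ #(nearAgreement ε M p)} : ℝ) := by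
        exact_mod_cast hunion
    _ ≤ ∑ _p : Fin m → (Fin t → Fin n) × ((Fin t → ZMod 2) → ZMod 2),
        2 ^ (m * n) * (2 ^ (s + 1) * E) ^ k := Finset.sum_le_sum fun p _ => hfix p
    _ = _ := by
        simp only [Finset.sum_const, Finset.card_univ, nsmul_eq_mul, Fintype.card_pi,
          Fintype.card_prod, ZMod.card, Fintype.card_fin, Finset.prod_const]
        push_cast
        ring

/-! ### From few wires to near agreement with juntas. -/

open Finset in
/-- A circuit with few wires has few gates of large fan-in. -/
theorem Circuit.card_heavy_mul_le {n m : ℕ} (C : Circuit n m) (q : ℕ) :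
    #{g | q < #(C.preds g)} * (q + 1) ≤ C.wires := by
  calc #{g | q < #(C.preds g)} * (q + 1) = ∑ g with q < #(C.preds g), (q + 1) := by simp
    _ ≤ ∑ g with q < #(C.preds g), #(C.preds g) :=
        Finset.sum_le_sum fun g hg => (Finset.mem_filter.1 hg).2
    _ ≤ C.wires := Finset.sum_le_sum_of_subset (Finset.filter_subset _ _)

/-- Half of the integer part of the binary logarithm is at least a quarter of the logarithm. -/
theorem logb_div_four_le {n : ℕ} (hn : 16 ≤ n) :
    Real.logb 2 n / 4 ≤ ((Nat.log 2 n / 2 : ℕ) : ℝ) := by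
  have hn0 : (0 : ℝ) < n := by exact_mod_cast (by omega : 0 < n)
  have h1 : Real.logb 2 n ≤ Nat.log 2 n + 1 := by
    rw [Real.logb_le_iff_le_rpow (by norm_num) hn0]
    have := (Nat.lt_pow_succ_log_self (b := 2) (by norm_num) n).le
    exact_mod_cast this
  -- This absorbs the two roundings, which cost at most 1 in total after halving.
  have h2 : 4 ≤ Real.logb 2 n := by
    rw [Real.le_logb_iff_rpow_le (by norm_num) hn0]
    norm_num
    exact_mod_cast hn
  have h3 : Nat.log 2 n ≤ 2 * (Nat.log 2 n / 2) + 1 := by omega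
  have h4 : (Nat.log 2 n : ℝ) ≤ 2 * ((Nat.log 2 n / 2 : ℕ) : ℝ) + 1 := by exact_mod_cast h3
  linarith

open Finset in
/-- A shallow circuit with few wires and with advantage for `M` yields a tuple of juntas that nearly
agrees with `M` on many inputs. -/
theorem Circuit.HasAdvantage.exists_nearAgreement {n m d r h : ℕ} {ε c : ℝ} (hn : 16 ≤ n)
    (hm : 0 < m) (hε : 0 < ε) (hr : 4 / ε ≤ 2 ^ r) (hd : 1 ≤ d) (hch : 4 * c * n ≤ h + 1)
    (hrh : r + h ≤ n) {C : Circuit n m}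
    {M : Matrix (Fin m) (Fin n) (ZMod 2)} (hC : C.HasAdvantage ε M) (hdepth : C.depth ≤ d)
    (hw : (C.wires : ℝ) < c * (n * Real.logb 2 n ^ (1 / d : ℝ))) :
    ∃ p : Fin m → (Fin (Nat.log 2 n / 2) → Fin n) ×
        ((Fin (Nat.log 2 n / 2) → ZMod 2) → ZMod 2),
      2 ^ (n - (r + h)) ≤ #(nearAgreement ε M p) := by
  set t := Nat.log 2 n / 2 with ht
  have hlog : 0 < Real.logb 2 n := Real.logb_pos (by norm_num) (by exact_mod_cast (by omega : 1 < n))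
  have hd0 : (0 : ℝ) < d := by exact_mod_cast hd
  have ht1 : 1 ≤ t := by
    have : Nat.log 2 16 ≤ Nat.log 2 n := Nat.log_mono_right hn
    have h16 : Nat.log 2 16 = 4 := Nat.log_pow (b := 2) (by norm_num) 4
    omega
  set q := ⌊(t : ℝ) ^ (1 / d : ℝ)⌋₊ with hq
  have hq1 : 1 ≤ q := Nat.le_floor <| by
    rw [Nat.cast_one]
    exact Real.one_le_rpow (by exact_mod_cast ht1) (by positivity)
  have hqt : q ^ d ≤ t := by
    have h1 : (q : ℝ) ^ d ≤ ((t : ℝ) ^ (1 / d : ℝ)) ^ d := by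
      gcongr
      exact Nat.floor_le (by positivity)
    rw [one_div, Real.rpow_inv_natCast_pow (by positivity) (by omega)] at h1
    exact_mod_cast h1
  have hroot : Real.logb 2 n ^ (1 / d : ℝ) / 4 ≤ q + 1 := by
    calc Real.logb 2 n ^ (1 / d : ℝ) / 4 ≤ Real.logb 2 n ^ (1 / d : ℝ) / 4 ^ (1 / d : ℝ) := by
          gcongr
          calc (4 : ℝ) ^ (1 / d : ℝ) ≤ 4 ^ (1 : ℝ) := by
                gcongr
                · norm_num
                · rw [div_le_one hd0]; exact_mod_cast hd
            _ = 4 := Real.rpow_one 4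
      _ = (Real.logb 2 n / 4) ^ (1 / d : ℝ) := by
          rw [Real.div_rpow hlog.le (by norm_num)]
      _ ≤ (t : ℝ) ^ (1 / d : ℝ) := by
          gcongr
          exact logb_div_four_le hn
      _ ≤ q + 1 := (Nat.lt_floor_add_one _).le
  have hheavy : #{g | q < #(C.preds g)} ≤ h := by
    have h1 : (#{g | q < #(C.preds g)} : ℝ) * (q + 1) ≤ C.wires := by
      exact_mod_cast C.card_heavy_mul_le q
    set L := Real.logb 2 n ^ (1 / d : ℝ) with hL
    have hLpos : 0 < L := Real.rpow_pos_of_pos hlog _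
    -- Cancelling `L` leaves fewer than `4 * c * n ≤ h + 1` heavy gates.
    have h2 : (#{g | q < #(C.preds g)} : ℝ) * (L / 4) < c * (n * L) :=
      ((mul_le_mul_of_nonneg_left hroot (Nat.cast_nonneg _)).trans h1).trans_lt hw
    have h3 : (#{g | q < #(C.preds g)} : ℝ) < h + 1 := by
      refine lt_of_mul_lt_mul_right ?_ hLpos.le
      nlinarith
    exact Nat.lt_succ_iff.1 (by exact_mod_cast h3)
  let G : Finset (Fin n → ZMod 2) :=
    {x | (1 + ε / 2) / 2 * m ≤ (agreement (M.mulVec x) (C.eval x) : ℝ)}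
  obtain ⟨p, hp⟩ := C.exists_juntaEval_eq (by omega) hdepth hq1 hqt G
  refine ⟨p, ?_⟩
  have hG : ε / 4 * 2 ^ n ≤ (#G : ℝ) := hC.card_agreement_ge hm hε
  have hsub : #{x ∈ G | C.eval x = juntaEval p x} ≤ #(nearAgreement ε M p) := by
    refine Finset.card_le_card fun x hx => ?_
    simp only [G, nearAgreement, Finset.mem_filter, Finset.mem_univ, true_and] at hx ⊢
    rw [← hx.2]
    exact hx.1
  have hbig : #G ≤ #(nearAgreement ε M p) * 2 ^ h :=
    hp.trans (Nat.mul_le_mul hsub (Nat.pow_le_pow_right (by norm_num) hheavy))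
  have hone : 1 ≤ ε / 4 * 2 ^ r := by
    rw [div_le_iff₀ hε] at hr
    linarith
  -- The density drops by at most `2 ^ r` from averaging and `2 ^ h` from fixing the heavy gates.
  have hfin : 2 ^ n ≤ (#(nearAgreement ε M p) * 2 ^ h) * 2 ^ r := by
    have : (2 : ℝ) ^ n ≤ (#(nearAgreement ε M p) * 2 ^ h) * 2 ^ r := by
      calc (2 : ℝ) ^ n ≤ 2 ^ n * (ε / 4 * 2 ^ r) := le_mul_of_one_le_right (by positivity) hone
        _ = ε / 4 * 2 ^ n * 2 ^ r := by ring
        _ ≤ #G * 2 ^ r := by gcongr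
        _ ≤ _ := by gcongr; exact_mod_cast hbig
    exact_mod_cast this
  have hsplit : 2 ^ n = 2 ^ (n - (r + h)) * (2 ^ h * 2 ^ r) := by
    rw [← pow_add, ← pow_add]; congr 1; omega
  rw [hsplit, mul_assoc] at hfin
  exact Nat.le_of_mul_le_mul_right hfin (by positivity)

/-! ### Asymptotic estimates and conclusion. -/

open Filter Asymptotics in
/-- The logarithm of the number of juntas is of smaller order than `n`. -/
theorem eventually_sqrt_mul_log_le {a : ℝ} (ha : 0 < a) :
    ∀ᶠ n : ℕ in atTop, √(n : ℝ) * (Real.log n + 1) ≤ a * (n / 4 : ℕ) := by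
  have h1 : (fun x : ℝ => Real.log x + 1) =o[atTop] fun x : ℝ => x ^ (1 / 2 : ℝ) := by
    refine (isLittleO_log_rpow_atTop (by norm_num)).add ?_
    exact isLittleO_const_left.2 <| Or.inr <|
      tendsto_norm_atTop_atTop.comp (tendsto_rpow_atTop (by norm_num))
  have h2 := (h1.bound (by positivity : 0 < a / 8)).natCast_atTop
  filter_upwards [h2, eventually_ge_atTop 4] with n hn hn4
  rw [← Real.sqrt_eq_rpow, Real.norm_of_nonneg (Real.sqrt_nonneg _)] at hn
  have h3 : Real.log n + 1 ≤ a / 8 * √(n : ℝ) := (Real.le_norm_self _).trans hn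
  have h4 : (n : ℝ) ≤ 8 * (n / 4 : ℕ) := by exact_mod_cast (by omega : n ≤ 8 * (n / 4))
  calc √(n : ℝ) * (Real.log n + 1) ≤ √(n : ℝ) * (a / 8 * √(n : ℝ)) := by gcongr
    _ = a / 8 * (√(n : ℝ) * √(n : ℝ)) := by ring
    _ = a / 8 * n := by rw [Real.mul_self_sqrt (Nat.cast_nonneg n)]
    _ ≤ a / 8 * (8 * (n / 4 : ℕ)) := by gcongr
    _ = a * (n / 4 : ℕ) := by ring

/-- The number of juntas on `Nat.log 2 n / 2` of `n` inputs. -/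
theorem card_junta_le_exp {n : ℕ} (hn : 1 ≤ n) :
    (n : ℝ) ^ (Nat.log 2 n / 2) * 2 ^ 2 ^ (Nat.log 2 n / 2) ≤
      Real.exp (√(n : ℝ) * (Real.log n + 1)) := by
  set t := Nat.log 2 n / 2
  have hn0 : (0 : ℝ) < n := by exact_mod_cast hn
  -- Taking half the logarithm for `t` keeps a truth table at `√n` bits.
  have h1 : ((2 ^ t : ℕ) : ℝ) ≤ √(n : ℝ) := by
    refine Real.le_sqrt_of_sq_le ?_
    have : (2 ^ t) ^ 2 ≤ n := by
      rw [← pow_mul]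
      refine (Nat.pow_le_pow_right (by norm_num) ?_).trans (Nat.pow_log_le_self 2 (by omega))
      exact Nat.div_mul_le_self _ _
    exact_mod_cast this
  have h2 : (t : ℝ) ≤ √(n : ℝ) :=
    le_trans (by exact_mod_cast Nat.lt_two_pow_self.le) h1
  have hlog : 0 ≤ Real.log n := Real.log_natCast_nonneg n
  have h3 : (n : ℝ) ^ t = Real.exp (t * Real.log n) := by
    rw [Real.exp_nat_mul, Real.exp_log hn0]
  have h4 : (2 : ℝ) ^ 2 ^ t ≤ Real.exp ((2 ^ t : ℕ) * 1) := by
    rw [Real.exp_nat_mul]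
    gcongr
    have := Real.add_one_le_exp 1
    linarith
  rw [h3]
  calc Real.exp (t * Real.log n) * 2 ^ 2 ^ t
      ≤ Real.exp (√(n : ℝ) * Real.log n) * Real.exp (√(n : ℝ)) := by
        gcongr
        refine h4.trans ?_
        rw [mul_one]
        gcongr
    _ = Real.exp (√(n : ℝ) * (Real.log n + 1)) := by
        rw [← Real.exp_add]; ring_nf

/-- A property that fails for few matrices holds for a large fraction of them. -/
theorem le_ncard_div_card_of_compl_subset {m n : ℕ} {η : ℝ}
    {P : Matrix (Fin m) (Fin n) (ZMod 2) → Prop} (B : Finset (Matrix (Fin m) (Fin n) (ZMod 2)))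
    (hB : (B.card : ℝ) ≤ η * 2 ^ (m * n)) (hP : ∀ M, M ∉ B → P M) :
    1 - η ≤ ({M : Matrix (Fin m) (Fin n) (ZMod 2) | P M}.ncard : ℝ) /
      (Nat.card (Matrix (Fin m) (Fin n) (ZMod 2)) : ℝ) := by
  classical
  have hcard : Nat.card (Matrix (Fin m) (Fin n) (ZMod 2)) = 2 ^ (m * n) := by
    rw [Matrix, Nat.card_fun, Nat.card_fun]
    simp [← pow_mul, mul_comm]
  have h1 : Bᶜ.card ≤ {M : Matrix (Fin m) (Fin n) (ZMod 2) | P M}.ncard := by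
    rw [← Set.ncard_coe_finset]
    exact Set.ncard_le_ncard (fun M hM => hP M (by simpa using hM)) (Set.toFinite _)
  have h2 : Bᶜ.card + B.card = 2 ^ (m * n) := by
    rw [add_comm, Finset.card_add_card_compl, Fintype.card_eq_nat_card, hcard]
  rw [hcard, Nat.cast_pow, Nat.cast_ofNat, le_div_iff₀ (by positivity)]
  have h1' : (Bᶜ.card : ℝ) ≤ {M : Matrix (Fin m) (Fin n) (ZMod 2) | P M}.ncard := by
    exact_mod_cast h1
  have h2' : (Bᶜ.card : ℝ) + B.card = 2 ^ (m * n) := by exact_mod_cast h2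
  linarith

open Filter in
open scoped Classical in
/-- Most linear operators have no shallow circuits with few wires and constant advantage. -/
theorem forMostOperators_wires_of_hasAdvantage {ε : ℝ} (hε : 0 < ε) :
    ∃ c : ℝ, 0 < c ∧
      ForMostOperators fun n m M =>
        ∀ d : ℕ, 1 ≤ d → ∀ C : Circuit n m, C.depth ≤ d → C.HasAdvantage ε M →
          c * (n * Real.logb 2 n ^ (1 / d : ℝ)) ≤ C.wires := by
  -- The first bound makes `2 ^ h` small against the Chernoff gain; the second leaves room for `k =
  -- n / 4` independent vectors.
  set δ : ℝ := min (ε ^ 2 / 64) (1 / 2) with hδ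
  have hδ0 : 0 < δ := by positivity
  obtain ⟨r, hr⟩ := pow_unbounded_of_one_lt (4 / ε) (by norm_num : (1 : ℝ) < 2)
  refine ⟨δ / 4, by positivity, fun K η hη => ?_⟩
  have hlarge : ∀ᶠ n : ℕ in atTop, ((r : ℝ) + 1) ≤ ε ^ 2 / 64 * n :=
    (tendsto_natCast_atTop_atTop.const_mul_atTop (by positivity)).eventually_ge_atTop _
  have hsmall : ∀ᶠ n : ℕ in atTop, Real.exp (-(ε ^ 2 / 16 * (n / 4 : ℕ))) ≤ η := by
    have h1 : Tendsto (fun n : ℕ => ε ^ 2 / 16 * ((n / 4 : ℕ) : ℝ)) atTop atTop :=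
      (tendsto_natCast_atTop_atTop.comp
        (Nat.tendsto_div_const_atTop (by norm_num : (4 : ℕ) ≠ 0))).const_mul_atTop (by positivity)
    exact (Real.tendsto_exp_neg_atTop_nhds_zero.comp h1).eventually_le_const hη
  filter_upwards [hlarge, hsmall, eventually_sqrt_mul_log_le (by positivity : 0 < ε ^ 2 / 32),
    eventually_ge_atTop 16, eventually_ge_atTop (4 * (r + 1))] with n hn1 hn2 hn3 hn16 hnr m hnm _
  set k := n / 4 with hk
  set h := ⌊δ * n⌋₊ with hh
  set t := Nat.log 2 n / 2 with ht
  have hhle : (h : ℝ) ≤ δ * n := Nat.floor_le (by positivity)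
  have hh2 : 2 * h ≤ n := by
    have h1 : δ * n ≤ 1 / 2 * n := by gcongr; exact min_le_right _ _
    have h2 : 2 * (h : ℝ) ≤ n := by linarith
    exact_mod_cast h2
  have hmR : (n : ℝ) ≤ m := by exact_mod_cast hnm
  have hm1 : (1 : ℝ) ≤ m := by exact_mod_cast (by omega : 1 ≤ m)
  -- The exceptional set does not mention `d`, so it serves all depths at once.
  refine le_ncard_div_card_of_compl_subset
    (Finset.univ.filter fun M : Matrix (Fin m) (Fin n) (ZMod 2) =>
      ∃ p : Fin m → (Fin t → Fin n) × ((Fin t → ZMod 2) → ZMod 2),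
        2 ^ (n - (r + h)) ≤ (nearAgreement ε M p).card) ?_ ?_
  · refine (card_exists_nearAgreement_le (k := k) hε (by omega)).trans ?_
    rw [mul_comm η]
    gcongr
    refine le_trans ?_ hn2
    have h1 : ((n : ℝ) ^ t * 2 ^ 2 ^ t) ^ m ≤ Real.exp (m * (ε ^ 2 / 32 * k)) := by
      rw [Real.exp_nat_mul]
      gcongr
      exact (card_junta_le_exp (by omega)).trans (Real.exp_le_exp.2 hn3)
    have h2 : (2 : ℝ) ^ (r + h + 1) ≤ Real.exp (ε ^ 2 / 32 * m) := by
      calc (2 : ℝ) ^ (r + h + 1) ≤ Real.exp 1 ^ (r + h + 1) := by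
            gcongr
            have := Real.add_one_le_exp 1
            linarith
        _ = Real.exp (r + h + 1 : ℕ) := by rw [← Real.exp_nat_mul, mul_one]
        _ ≤ Real.exp (ε ^ 2 / 32 * m) := by
            gcongr
            push_cast
            have h3 : δ * n ≤ ε ^ 2 / 64 * n := by gcongr; exact min_le_left _ _
            have h4 : ε ^ 2 / 32 * n ≤ ε ^ 2 / 32 * m := by gcongr
            linarith
    -- Of the exponent `4 / 32` (in units of `ε ^ 2 * m * k`) the density loss takes `1 / 32` and
    -- the union bound another, leaving `1 / 16`.
    have h3 : (2 ^ (r + h + 1) * Real.exp (-(ε ^ 2 / 8) * m)) ^ k ≤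
        Real.exp (k * (-(ε ^ 2 * 3 / 32) * m)) := by
      rw [Real.exp_nat_mul]
      gcongr
      calc 2 ^ (r + h + 1) * Real.exp (-(ε ^ 2 / 8) * m)
          ≤ Real.exp (ε ^ 2 / 32 * m) * Real.exp (-(ε ^ 2 / 8) * m) := by gcongr
        _ = Real.exp (-(ε ^ 2 * 3 / 32) * m) := by rw [← Real.exp_add]; ring_nf
    calc ((n : ℝ) ^ t * 2 ^ 2 ^ t) ^ m * (2 ^ (r + h + 1) * Real.exp (-(ε ^ 2 / 8) * m)) ^ k
        ≤ Real.exp (m * (ε ^ 2 / 32 * k)) * Real.exp (k * (-(ε ^ 2 * 3 / 32) * m)) := by gcongr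
      _ = Real.exp (-(ε ^ 2 / 16 * k * m)) := by rw [← Real.exp_add]; ring_nf
      _ ≤ Real.exp (-(ε ^ 2 / 16 * k)) := by
          exact Real.exp_le_exp.2 <| neg_le_neg <| le_mul_of_one_le_right (by positivity) hm1
  · intro M hM d hd C hdepth hC
    by_contra! hw
    refine hM (Finset.mem_filter.2 ⟨Finset.mem_univ _, ?_⟩)
    refine hC.exists_nearAgreement hn16 (by omega) hε hr.le hd ?_ (by omega) hdepth hw
    have := (Nat.lt_floor_add_one (δ * n)).le
    linarith

/-- A circuit that computes an operator has advantage `1` for it. -/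
theorem Circuit.Computes.hasAdvantage_one {n m : ℕ} {C : Circuit n m}
    {M : Matrix (Fin m) (Fin n) (ZMod 2)} (h : C.Computes M) : C.HasAdvantage 1 M := by
  intro i
  have : (Finset.univ.filter fun x : Fin n → ZMod 2 => C.eval x i = M.mulVec x i) = Finset.univ :=
    Finset.filter_true_of_mem fun x _ => congrFun (h x) i
  rw [this]
  simp

theorem theorem4p1 :
    (∃ c : ℝ, 0 < c ∧
      ForMostOperators fun n m M =>
        ∀ d : ℕ, 1 ≤ d → ∀ C : Circuit n m, C.depth ≤ d → C.Computes M →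
          c * (n * Real.logb 2 n ^ (1 / d : ℝ)) ≤ C.wires) ∧
    (∀ ε : ℝ, 0 < ε → ∃ c : ℝ, 0 < c ∧
      ForMostOperators fun n m M =>
        ∀ d : ℕ, 1 ≤ d → ∀ C : Circuit n m, C.depth ≤ d → C.HasAdvantage ε M →
          c * (n * Real.logb 2 n ^ (1 / d : ℝ)) ≤ C.wires) := by
  refine ⟨?_, fun ε hε => forMostOperators_wires_of_hasAdvantage hε⟩
  -- Exact computation is the case of advantage 1.
  obtain ⟨c, hc, h⟩ := forMostOperators_wires_of_hasAdvantage one_pos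
  refine ⟨c, hc, fun K η hη => ?_⟩
  filter_upwards [h K η hη] with n hn m hnm hmK
  refine (hn m hnm hmK).trans (div_le_div_of_nonneg_right (Nat.cast_le.2 ?_) (Nat.cast_nonneg _))
  exact Set.ncard_le_ncard (fun M hM d hd C hdepth hC => hM d hd C hdepth hC.hasAdvantage_one)
    (Set.toFinite _)
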